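/- All simplicial complexes are finite and abstract; $f_0$ is the number of vertices. Let $d\ge 3$ and let $\Delta$ be a (closed) combinatorial $d$-manifold, i.e. a pure connected $d$-dimensional complex in which the link of every vertex is a combinatorial $(d-1)$-sphere (a pure $(d-1)$-dimensional complex that is PL-homeomorphic to the boundary of the $d$-simplex). Let $\mathrm{Bd}(\Delta)$ be its barycentric subdivision, whose vertices $v_F$ are the nonempty faces $F$ of $\Delta$ and whose faces are the chains of nonempty faces. Definitions. A $d$-dimensional complex $K$ is balanced if its vertices can be coloured with $d+1$ colours so that adjacent vertices get different colours. Let $\partial\mathcal C_{d+1}$ be the boundary of the $(d+1)$-dimensional cross-polytope, with pairs of opposite vertices $i, v_i$ ($0\le i\le d$). A cross-flip on a pure $d$-dimensional complex $K$ replaces an induced subcomplex $\Phi\subseteq K$ that is a PL $d$-ball and is identified with a subcomplex of $\partial\mathcal C_{d+1}$ by its complement: $\chi_\Phi(K)=(K\setminus\Phi)\cup(\partial\mathcal C_{d+1}\setminus\Phi)$, where $A\setminus B$ is the subcomplex of $A$ generated by the facets of $A$ that are not in $B$. It is basic if, under the identification, $\Phi=\bigcup_{i\in I}\Phi_i$ for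 some $I\subseteq\{0,\dots,d+1\}$, where for $i\le d$ the complex $\Phi_i$ is the join of the full simplex on $\{0,\dots,i-1,v_i\}$ with the two-point complexes $\{j\},\{v_j\}$, $i<j\le d$, and $\Phi_{d+1}$ is the full simplex on $\{0,\dots,d\}$. A down-flip is a basic cross-flip that decreases the number of vertices. A vertex $v$ of $K$ is removable if $v\notin\chi_\Phi(K)$ for some down-flip $\chi_\Phi$ on $K$. A balanced complex is irreducible if it has no removable vertex. Then: (1) $\mathrm{Bd}(\Delta)$ is irreducible, that is, it is balanced (as a $d$-dimensional complex) and has no removable vertex. (2) For every $k$-face $F$ of $\Delta$ $(k\ge 0)$, $$f_0\bigl(\mathrm{lk}_{\mathrm{Bd}(\Delta)}(v_F)\bigr)\ \ge\ 2^{d-k+1}+2^{k+1}-4\ >\ 2d .$$ (3) In contrast, if $K$ is any pure $d$-dimensional balanced complex and $v$ is a removable vertex of $K$, then $f_0(\mathrm{lk}_K(v))=2d$. -/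

import Mathlib

namespace CrossFlips

/-! Abstract simplicial complexes are Mathlib's `PreAbstractSimplicialComplex V` on a finite type
`V`: families of nonempty finite sets (the nonempty faces) that are closed under nonempty subsets;
not every element of `V` has to be a vertex. -/

/-- The set of vertices. -/
def vertexSet {V : Type*} (K : PreAbstractSimplicialComplex V) : Set V :=
  {v | {v} ∈ K.faces}

/-- The number `f_0` of vertices. -/
noncomputable def numVertices {V : Type*} (K : PreAbstractSimplicialComplex V) : ℕ :=
  (vertexSet K).ncard

/-- `K` has dimension `d`. -/
def HasDim {V : Type*} (d : ℕ) (K : PreAbstractSimplicialComplex V) : Prop :=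
  (∃ s ∈ K.faces, s.card = d + 1) ∧ ∀ s ∈ K.faces, s.card ≤ d + 1

/-- `K` is pure of dimension `d`: all its facets have dimension `d`. -/
def IsPure {V : Type*} (d : ℕ) (K : PreAbstractSimplicialComplex V) : Prop :=
  HasDim d K ∧ ∀ s ∈ K.faces, ∃ t ∈ K.faces, s ⊆ t ∧ t.card = d + 1

/-- The (nonempty faces of the) link of the face `F` in `K`. -/
def link {V : Type*} [DecidableEq V] (K : PreAbstractSimplicialComplex V) (F : Finset V) :
    PreAbstractSimplicialComplex V where
  faces := {G | G.Nonempty ∧ Disjoint F G ∧ F ∪ G ∈ K.faces}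
  isRelLowerSet_faces := by
    rintro G ⟨hG, hd, hF⟩
    refine ⟨hG, fun H hHG hH => ⟨hH, hd.mono_right hHG, ?_⟩⟩
    exact (K.isRelLowerSet_faces hF).2 (Finset.union_subset_union_right hHG)
      (hH.mono Finset.subset_union_right)

/-- A `d`-dimensional complex is balanced if its vertices can be coloured with `d + 1` colours so
that adjacent vertices have different colours. -/
def IsBalanced {V : Type*} [DecidableEq V] (d : ℕ) (K : PreAbstractSimplicialComplex V) : Prop :=
  HasDim d K ∧ ∃ κ : V → Fin (d + 1), ∀ i j, i ≠ j → {i, j} ∈ K.faces → κ i ≠ κ j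

/-- The barycentric subdivision: its vertices are the nonempty faces of `K`, and its faces are the
nonempty chains of nonempty faces of `K`. -/
def barycentricSubdivision {V : Type*} (K : PreAbstractSimplicialComplex V) :
    PreAbstractSimplicialComplex (Finset V) where
  faces := {C | C.Nonempty ∧ (∀ F ∈ C, F ∈ K.faces) ∧
    IsChain (· ⊆ ·) (C : Set (Finset V))}
  isRelLowerSet_faces := by
    rintro C ⟨hC, hK, hch⟩
    exact ⟨hC, fun D hDC hD => ⟨hD, fun F hF => hK F (hDC hF),
      hch.mono (Finset.coe_subset.mpr hDC)⟩⟩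

/-! ### Geometric realization, PL homeomorphisms, combinatorial manifolds -/

/-- The geometric simplex in `ℝ^V` spanned by the standard basis vectors `e_v` with `v ∈ s`. -/
def geomSimplex {V : Type*} [DecidableEq V] (s : Finset V) : Set (V → ℝ) :=
  convexHull ℝ ((fun v : V => (Pi.single v 1 : V → ℝ)) '' (s : Set V))

/-- The geometric realization `|K|` in `ℝ^V`, for a finite set `V`. -/
def realization {V : Type*} [DecidableEq V] (K : PreAbstractSimplicialComplex V) :
    Set (V → ℝ) :=
  ⋃ s ∈ K.faces, geomSimplex s

/-- The finite geometric simplicial complex `T` is a subdivision of (the realization of) `K`. -/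
def IsSubdivision {V : Type*} [DecidableEq V] (K : PreAbstractSimplicialComplex V)
    (T : Geometry.SimplicialComplex ℝ (V → ℝ)) : Prop :=
  T.faces.Finite ∧ T.space = realization K ∧
    ∀ t ∈ T.faces, ∃ s ∈ K.faces, convexHull ℝ (t : Set (V → ℝ)) ⊆ geomSimplex s

/-- `|K|` and `|L|` are PL homeomorphic: some homeomorphism is affine on every simplex of some
subdivision of `K`. -/
def PLHomeomorphic {V W : Type*} [DecidableEq V] [DecidableEq W]
    (K : PreAbstractSimplicialComplex V) (L : PreAbstractSimplicialComplex W) : Prop :=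
  ∃ (f : realization K ≃ₜ realization L) (T : Geometry.SimplicialComplex ℝ (V → ℝ)),
    IsSubdivision K T ∧
    ∀ t ∈ T.faces, ∃ A : (V → ℝ) →ᵃ[ℝ] (W → ℝ),
      ∀ x : realization K, (x : V → ℝ) ∈ convexHull ℝ (t : Set (V → ℝ)) →
        (f x : W → ℝ) = A (x : V → ℝ)

/-- The boundary complex of the `n`-simplex on the `n + 1` vertices `Fin (n + 1)`. -/
def simplexBoundary (n : ℕ) : PreAbstractSimplicialComplex (Fin (n + 1)) where
  faces := {s | s.Nonempty ∧ s ≠ Finset.univ}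
  isRelLowerSet_faces := by
    rintro s ⟨hs, hu⟩
    refine ⟨hs, fun t hts ht => ⟨ht, ?_⟩⟩
    rintro rfl
    exact hu (Finset.univ_subset_iff.mp hts)

/-- Combinatorial `d`-spheres. -/
def IsCombinatorialSphere {V : Type*} [DecidableEq V] (d : ℕ)
    (K : PreAbstractSimplicialComplex V) : Prop :=
  IsPure d K ∧ PLHomeomorphic K (simplexBoundary (d + 1))

/-- `K` is a PL `d`-ball; `⊤` is the full `d`-simplex on the vertex set `Fin (d + 1)`. -/
def IsPLBall {V : Type*} [DecidableEq V] (d : ℕ) (K : PreAbstractSimplicialComplex V) : Prop :=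
  PLHomeomorphic K (⊤ : PreAbstractSimplicialComplex (Fin (d + 1)))

/-- (Closed) combinatorial `d`-manifolds, `d ≥ 1`. -/
def IsCombinatorialManifold {V : Type*} [DecidableEq V] (d : ℕ)
    (K : PreAbstractSimplicialComplex V) : Prop :=
  IsPure d K ∧ IsConnected (realization K) ∧
    ∀ v ∈ vertexSet K, IsCombinatorialSphere (d - 1) (link K {v})

/-! ### Cross-flips -/

/-- Vertices of the `(d+1)`-dimensional cross-polytope: `(i, false)` is the vertex `i` and
`(i, true)` is the opposite vertex `v_i`, for `0 ≤ i ≤ d`. -/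
abbrev CrossVertex (d : ℕ) : Type := Fin (d + 1) × Bool

/-- The boundary complex of the `(d+1)`-dimensional cross-polytope: the nonempty sets of vertices
without two opposite ones. -/
def crossBoundary (d : ℕ) : PreAbstractSimplicialComplex (CrossVertex d) where
  faces := {s | s.Nonempty ∧ ∀ i, ¬ ((i, false) ∈ s ∧ (i, true) ∈ s)}
  isRelLowerSet_faces := by
    rintro s ⟨hs, ha⟩
    exact ⟨hs, fun t hts ht => ⟨ht, fun i h => ha i ⟨hts h.1, hts h.2⟩⟩⟩

/-- The subcomplex `Φ_I = ⋃_{i ∈ I} Φ_i` of the boundary of the cross-polytope, for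
`I ⊆ {0, …, d+1}`, where `Φ_i` is the join of the full simplex on `{0, …, i-1, v_i}`
(on `{0, …, d}` if `i = d + 1`) and of the pairs of points `{j}, {v_j}` for `i < j ≤ d`.
So the faces of `Φ_i` are the faces of the boundary of the cross-polytope that contain no `v_j`
with `j < i` and do not contain the vertex `i`. -/
def crossPhi (d : ℕ) (I : Finset (Fin (d + 2))) : PreAbstractSimplicialComplex (CrossVertex d) where
  faces := {s | s ∈ (crossBoundary d).faces ∧ ∃ i ∈ I, ∀ j : Fin (d + 1),
    ((j : ℕ) < i → (j, true) ∉ s) ∧ ((j : ℕ) = i → (j, false) ∉ s)}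
  isRelLowerSet_faces := by
    rintro s ⟨hs, i, hi, h⟩
    refine ⟨hs.1, fun t hts ht => ⟨((crossBoundary d).isRelLowerSet_faces hs).2 hts ht, i, hi, ?_⟩⟩
    exact fun j => ⟨fun hj hm => (h j).1 hj (hts hm), fun hj hm => (h j).2 hj (hts hm)⟩

/-- `K \ L`: the subcomplex of `K` generated by the facets of `K` that are not in `L`. -/
def complementComplex {V : Type*} (K L : PreAbstractSimplicialComplex V) :
    PreAbstractSimplicialComplex V where
  faces := {s | s.Nonempty ∧ ∃ t, Maximal (· ∈ K.faces) t ∧ t ∉ L.faces ∧ s ⊆ t}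
  isRelLowerSet_faces := by
    rintro s ⟨hs, t, ht, hL, hst⟩
    exact ⟨hs, fun u hus hu => ⟨hu, t, ht, hL, hus.trans hst⟩⟩

/-- The data of a cross-flip on a pure `d`-dimensional complex `K`: an induced subcomplex `Φ` of
`K` that is a PL `d`-ball, and an isomorphism `pos` from `Φ` to a subcomplex of the boundary of the
`(d+1)`-dimensional cross-polytope. (The values of `pos` outside the vertices of `Φ` are
irrelevant.) -/
structure CrossFlip {V : Type*} [DecidableEq V] (d : ℕ) (K : PreAbstractSimplicialComplex V) where
  Φ : PreAbstractSimplicialComplex V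
  pos : V → CrossVertex d
  pure : IsPure d K
  le : Φ ≤ K
  induced : ∀ s ∈ K.faces, (∀ v ∈ s, v ∈ vertexSet Φ) → s ∈ Φ.faces
  ball : IsPLBall d Φ
  injOn : Set.InjOn pos (vertexSet Φ)
  map_le : Φ.map pos ≤ crossBoundary d

/-- Identifies the vertices in the image of `Φ` with the corresponding old vertices; the other
vertices of the cross-polytope are new vertices. -/
noncomputable def CrossFlip.glue {V : Type*} [DecidableEq V] {d : ℕ}
    {K : PreAbstractSimplicialComplex V} (χ : CrossFlip d K) (c : CrossVertex d) :
    V ⊕ CrossVertex d :=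
  open Classical in
  if h : ∃ v ∈ vertexSet χ.Φ, χ.pos v = c then Sum.inl h.choose else Sum.inr c

/-- The complex `χ_Φ(K) = (K \ Φ) ∪ (∂C_{d+1} \ Φ)`, where the second part is glued in along the
identification of `Φ` with a subcomplex of `∂C_{d+1}`. An old vertex `v` is written `Sum.inl v`. -/
noncomputable def CrossFlip.result {V : Type*} [DecidableEq V] {d : ℕ}
    {K : PreAbstractSimplicialComplex V} (χ : CrossFlip d K) :
    PreAbstractSimplicialComplex (V ⊕ CrossVertex d) :=
  (complementComplex K χ.Φ).map Sum.inl ⊔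
    (complementComplex (crossBoundary d) (χ.Φ.map χ.pos)).map χ.glue

/-- Basic cross-flips: those that replace some `Φ_I`. -/
def CrossFlip.IsBasic {V : Type*} [DecidableEq V] {d : ℕ} {K : PreAbstractSimplicialComplex V}
    (χ : CrossFlip d K) : Prop :=
  ∃ I : Finset (Fin (d + 2)), χ.Φ.map χ.pos = crossPhi d I

/-- Down-flips: basic cross-flips that decrease the number of vertices. -/
def CrossFlip.IsDown {V : Type*} [DecidableEq V] {d : ℕ} {K : PreAbstractSimplicialComplex V}
    (χ : CrossFlip d K) : Prop :=
  χ.IsBasic ∧ numVertices χ.result < numVertices K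

/-- The vertex `v` of the `d`-dimensional complex `K` is removable. -/
def IsRemovable {V : Type*} [DecidableEq V] (d : ℕ) (K : PreAbstractSimplicialComplex V)
    (v : V) : Prop :=
  v ∈ vertexSet K ∧ ∃ χ : CrossFlip d K, χ.IsDown ∧ Sum.inl v ∉ vertexSet χ.result

/-- A balanced `d`-dimensional complex is irreducible if it has no removable vertex. -/
def IsIrreducible {V : Type*} [DecidableEq V] (d : ℕ) (K : PreAbstractSimplicialComplex V) :
    Prop :=
  IsBalanced d K ∧ ∀ v, ¬ IsRemovable d K v

end CrossFlips

namespace CrossFlips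

/-! ### Removable vertices -/

/-! The number of neighbours distinguishes the vertices of a barycentric subdivision from removable
ones. If a flip deletes `v`, then all facets of `K` at `v` lie in `Φ`, and all facets of the
cross-polytope boundary at `χ.pos v` lie in the image of `Φ`. So `v` has as many neighbours as a
cross-polytope vertex: every vertex except itself and its opposite, `2 * d` in all
(`numVertices_link_of_isRemovable`).

In the subdivision, the neighbours of `F` are its proper nonempty subsets, `2 ^ (k + 1) - 2` of
them, and the faces properly containing it. The latter are bounded below by induction on the
codimension (`two_pow_sub_one_le_ncard_star`), using only that each codimension-one face of a facet
lies in a second facet.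

That exchange property passes from vertex links to the manifold. For a PL sphere it is proved by
convexity (`not_plHomeomorphic_of_unique_facet`): at a free codimension-one face, some point has a
convex neighbourhood on which the PL homeomorphism is affine. Its image is a convex neighbourhood in
the simplex boundary, so segments ending at the image point can be prolonged within it, whereas at
the free face they cannot. -/

lemma exists_maximal_face {V : Type*} [Fintype V] (K : PreAbstractSimplicialComplex V)
    {s : Finset V} (hs : s ∈ K.faces) : ∃ t, Maximal (· ∈ K.faces) t ∧ s ⊆ t := by
  obtain ⟨t, hst, ht⟩ := (Set.toFinite K.faces).exists_le_maximal hs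
  exact ⟨t, ht, hst⟩

/-- If `v` is missing from the complement, every facet through `v` lies in `L`, hence so does the
whole star of `v`. -/
lemma mem_of_not_mem_complementComplex {V : Type*} [Fintype V]
    {K L : PreAbstractSimplicialComplex V} {s : Finset V} {v : V} (hs : s ∈ K.faces) (hv : v ∈ s)
    (h : {v} ∉ (complementComplex K L).faces) : s ∈ L.faces := by
  obtain ⟨t, ht, hst⟩ := exists_maximal_face K hs
  by_contra hsL
  refine h ⟨Finset.singleton_nonempty v, t, ht, fun htL => hsL ?_, by simpa using hst hv⟩
  exact (L.isRelLowerSet_faces htL).2 hst ⟨v, hv⟩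

lemma singleton_mem_map {V W : Type*} [DecidableEq W] {K : PreAbstractSimplicialComplex V}
    {v : V} (f : V → W) (h : {v} ∈ K.faces) : {f v} ∈ (K.map f).faces :=
  ⟨{v}, h, by simp⟩

lemma CrossFlip.glue_pos {V : Type*} [DecidableEq V] {d : ℕ} {K : PreAbstractSimplicialComplex V}
    (χ : CrossFlip d K) {v : V} (hv : v ∈ vertexSet χ.Φ) : χ.glue (χ.pos v) = Sum.inl v := by
  have h : ∃ w ∈ vertexSet χ.Φ, χ.pos w = χ.pos v := ⟨v, hv, rfl⟩
  rw [CrossFlip.glue, dif_pos h]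
  exact congrArg _ (χ.injOn h.choose_spec.1 hv h.choose_spec.2)

lemma pair_mem_crossBoundary {d : ℕ} (a b : CrossVertex d) :
    {a, b} ∈ (crossBoundary d).faces ↔ b ≠ (a.1, !a.2) := by
  obtain ⟨i, x⟩ := a
  obtain ⟨j, y⟩ := b
  simp only [crossBoundary, Set.mem_ofPred_eq, Finset.mem_insert, Finset.mem_singleton, Prod.mk.injEq,
    ne_eq, Finset.insert_nonempty, true_and]
  constructor
  · rintro h ⟨rfl, rfl⟩
    cases x <;> simpa using h j
  · intro h k
    cases x <;> cases y <;> grind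

lemma mem_vertexSet_link {V : Type*} [DecidableEq V] {K : PreAbstractSimplicialComplex V}
    {v w : V} : w ∈ vertexSet (link K {v}) ↔ v ≠ w ∧ {v, w} ∈ K.faces := by
  simp only [vertexSet, link, Set.mem_ofPred_eq, Finset.singleton_nonempty, true_and,
    Finset.disjoint_singleton_left, Finset.mem_singleton, ← Finset.insert_eq, ne_eq]

lemma vertex_of_mem {V : Type*} {K : PreAbstractSimplicialComplex V} {s : Finset V} {v : V}
    (hs : s ∈ K.faces) (hv : v ∈ s) : {v} ∈ K.faces :=
  (K.isRelLowerSet_faces hs).2 (by simpa using hv) (Finset.singleton_nonempty v)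

theorem numVertices_link_of_isRemovable {V : Type*} [Fintype V] [DecidableEq V] {d : ℕ}
    {K : PreAbstractSimplicialComplex V} {v : V} (h : IsRemovable d K v) :
    numVertices (link K {v}) = 2 * d := by
  obtain ⟨hv, χ, -, hres⟩ := h
  have h1 : {v} ∉ (complementComplex K χ.Φ).faces := fun h =>
    hres (Or.inl (singleton_mem_map Sum.inl h))
  have hvΦ : v ∈ vertexSet χ.Φ := mem_of_not_mem_complementComplex hv (by simp) h1
  have h2 : {χ.pos v} ∉ (complementComplex (crossBoundary d) (χ.Φ.map χ.pos)).faces := fun h => by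
    have := singleton_mem_map χ.glue h
    rw [χ.glue_pos hvΦ] at this
    exact hres (Or.inr this)
  have hcard : (vertexSet (link K {v})).ncard
      = ((({χ.pos v, ((χ.pos v).1, !(χ.pos v).2)} : Finset (CrossVertex d))ᶜ : Finset _) :
        Set (CrossVertex d)).ncard := by
    -- `χ.pos` matches the neighbours of `v` with the vertices other than `χ.pos v` and its
    -- opposite.
    refine Set.ncard_congr (fun w _ => χ.pos w) ?_ ?_ ?_
    · intro w hw
      rw [mem_vertexSet_link] at hw
      have hΦ := mem_of_not_mem_complementComplex hw.2 (by simp) h1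
      have hwΦ : w ∈ vertexSet χ.Φ := vertex_of_mem hΦ (by simp)
      have h3 : {χ.pos v, χ.pos w} ∈ (crossBoundary d).faces :=
        χ.map_le ⟨_, hΦ, by simp [Finset.image_insert]⟩
      rw [pair_mem_crossBoundary] at h3
      have h4 : χ.pos w ≠ χ.pos v := fun h => hw.1 (χ.injOn hvΦ hwΦ h.symm)
      simp [h3, h4]
    · intro a b ha hb hab
      rw [mem_vertexSet_link] at ha hb
      exact χ.injOn (vertex_of_mem (mem_of_not_mem_complementComplex ha.2 (by simp) h1) (by simp))
        (vertex_of_mem (mem_of_not_mem_complementComplex hb.2 (by simp) h1) (by simp)) hab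
    · intro c hc
      simp only [Finset.coe_compl, Set.mem_compl_iff, Finset.coe_insert, Finset.coe_singleton,
        Set.mem_insert_iff, Set.mem_singleton_iff, not_or] at hc
      -- Surjectivity: the edge from `χ.pos v` to `c` lies in the star of `χ.pos v`, hence comes
      -- from a face of `Φ`.
      have h3 := mem_of_not_mem_complementComplex ((pair_mem_crossBoundary (χ.pos v) c).2 hc.2)
        (by simp) h2
      obtain ⟨s, hs, hsc⟩ := h3
      dsimp only at hsc
      have hvs : v ∈ s := by
        have : χ.pos v ∈ s.image χ.pos := by rw [hsc]; simp
        obtain ⟨v', hv', h⟩ := Finset.mem_image.1 this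
        rwa [← χ.injOn (vertex_of_mem hs hv') hvΦ h]
      obtain ⟨w, hw, rfl⟩ : ∃ w ∈ s, χ.pos w = c := by
        have : c ∈ s.image χ.pos := by rw [hsc]; simp
        exact Finset.mem_image.1 this
      refine ⟨w, ?_, rfl⟩
      rw [mem_vertexSet_link]
      refine ⟨fun h => hc.1 (by rw [h]), χ.le ((χ.Φ.isRelLowerSet_faces hs).2 ?_ (by simp))⟩
      intro x hx
      rcases Finset.mem_insert.1 hx with rfl | hx
      · exact hvs
      · rwa [Finset.mem_singleton.1 hx]
  rw [numVertices, hcard, Set.ncard_coe_finset, Finset.card_compl, Finset.card_pair]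
  · simp; omega
  · intro h
    have := congrArg Prod.snd h
    simp at this

/-! ### Counting faces -/

/-- Every codimension-one face of a facet lies in a second facet. -/
def HasFacetExchange {V : Type*} [DecidableEq V] (d : ℕ) (K : PreAbstractSimplicialComplex V) :
    Prop :=
  ∀ σ ∈ K.faces, σ.card = d + 1 → ∀ w ∈ σ, ∃ w' ∉ σ, insert w' (σ.erase w) ∈ K.faces

/-- For a vertex `v` outside `F` in a facet containing `F`, the faces over `insert v F` count twice,
with `v` and with `v` erased. The exchanged facet adds one more: `2 * (2 ^ (e + 1) - 1) + 1 = 2 ^ (e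
+ 2) - 1`. -/
lemma two_pow_sub_one_le_ncard_star {V : Type*} [Fintype V] [DecidableEq V] {d : ℕ}
    {K : PreAbstractSimplicialComplex V} (hK : IsPure d K) (hx : HasFacetExchange d K) (e : ℕ) :
    ∀ F ∈ K.faces, F.card + e = d + 1 → 2 ^ (e + 1) - 1 ≤ {G | G ∈ K.faces ∧ F ⊆ G}.ncard := by
  induction e with
  | zero =>
    intro F hF _
    have : 0 < {G | G ∈ K.faces ∧ F ⊆ G}.ncard :=
      (Set.ncard_pos (Set.toFinite _)).2 ⟨F, hF, subset_rfl⟩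
    exact this
  | succ e ih =>
    intro F hF hcard
    obtain ⟨σ, hσ, hFσ, hσc⟩ := hK.2 F hF
    obtain ⟨v, hvσ, hvF⟩ : ∃ v ∈ σ, v ∉ F := by
      by_contra! h
      have := Finset.card_le_card (show σ ⊆ F from h)
      omega
    have hFv : insert v F ∈ K.faces :=
      (K.isRelLowerSet_faces hσ).2 (Finset.insert_subset hvσ hFσ) (by simp)
    have hFne := (K.isRelLowerSet_faces hF).1
    have ih' := ih (insert v F) hFv (by rw [Finset.card_insert_of_notMem hvF]; omega)
    obtain ⟨w', hw', hσ'⟩ := hx σ hσ hσc v hvσ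
    set A := {G | G ∈ K.faces ∧ insert v F ⊆ G} with hA
    have hFe : ∀ G ∈ A, F ⊆ G.erase v := fun G hG x hx =>
      Finset.mem_erase.2 ⟨fun h => hvF (h ▸ hx), hG.2 (Finset.mem_insert_of_mem hx)⟩
    have hinj : Set.InjOn (fun G : Finset V => G.erase v) A := by
      intro G hG H hH h
      have hvG : v ∈ G := hG.2 (by simp)
      have hvH : v ∈ H := hH.2 (by simp)
      rw [← Finset.insert_erase hvG, ← Finset.insert_erase hvH]
      exact congrArg _ h
    set B := (fun G : Finset V => G.erase v) '' A with hB
    have hBc : B.ncard = A.ncard := hinj.ncard_image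
    set τ := insert w' (σ.erase v) with hτ
    have hτc : τ.card = d + 1 := by
      rw [hτ, Finset.card_insert_of_notMem (by simp [hw']), Finset.card_erase_of_mem hvσ]
      omega
    -- Members of `B` have lost a vertex, so they are too small to be facets.
    have hτB : τ ∉ B := by
      rintro ⟨G, hG, h⟩
      have h1 := hK.1.2 G hG.1
      have h2 := Finset.card_erase_of_mem (hG.2 (Finset.mem_insert_self v F))
      dsimp only at h
      rw [h] at h2
      omega
    have hvτ : v ∉ τ := by
      rw [hτ, Finset.mem_insert]
      rintro (h | h)
      · exact hw' (h ▸ hvσ)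
      · simp at h
    have hdisj : Disjoint A (insert τ B) := by
      rw [Set.disjoint_left]
      rintro G hG (rfl | ⟨H, hH, rfl⟩)
      · exact hvτ (hG.2 (by simp))
      · have := hG.2 (Finset.mem_insert_self v F)
        simp at this
    have hsub : A ∪ insert τ B ⊆ {G | G ∈ K.faces ∧ F ⊆ G} := by
      rintro G (hG | rfl | ⟨H, hH, rfl⟩)
      · exact ⟨hG.1, (Finset.subset_insert v F).trans hG.2⟩
      · refine ⟨hσ', fun x hx => Finset.mem_insert_of_mem (Finset.mem_erase.2 ⟨?_, hFσ hx⟩)⟩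
        exact fun h => hvF (h ▸ hx)
      · exact ⟨(K.isRelLowerSet_faces hH.1).2 (Finset.erase_subset v H) (hFne.mono (hFe H hH)),
          hFe H hH⟩
    have := Set.ncard_le_ncard hsub (Set.toFinite _)
    rw [Set.ncard_union_eq hdisj (Set.toFinite _) (Set.toFinite _),
      Set.ncard_insert_of_notMem hτB (Set.toFinite _), hBc] at this
    have h2 : 2 ^ (e + 1 + 1) = 2 * 2 ^ (e + 1) := by ring
    omega

lemma le_numVertices_link_barycentricSubdivision {V : Type*} [Fintype V] [DecidableEq V] {d k : ℕ}
    {K : PreAbstractSimplicialComplex V} (hK : IsPure d K) (hx : HasFacetExchange d K)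
    {F : Finset V} (hF : F ∈ K.faces) (hk : F.card = k + 1) :
    2 ^ (d - k + 1) + 2 ^ (k + 1) - 4 ≤ numVertices (link (barycentricSubdivision K) {F}) := by
  have hkd : k ≤ d := by have := hK.1.2 F hF; omega
  have h1 := two_pow_sub_one_le_ncard_star hK hx (d - k) F hF (by omega)
  set A := {G | G ∈ K.faces ∧ F ⊆ G} with hA
  set B : Set (Finset V) := ((F.powerset.erase ∅ : Finset (Finset V)) : Set (Finset V)) with hB
  have hFne := (K.isRelLowerSet_faces hF).1
  have hBc : B.ncard = 2 ^ (k + 1) - 1 := by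
    rw [hB, Set.ncard_coe_finset, Finset.card_erase_of_mem (by simp), Finset.card_powerset, hk]
  have hFA : F ∈ A := ⟨hF, subset_rfl⟩
  have hFB : F ∈ B := by simp [hB, hFne.ne_empty]
  have hdisj : Disjoint (A \ {F}) (B \ {F}) := by
    rw [Set.disjoint_left]
    rintro G ⟨hG, hGF⟩ ⟨hG', -⟩
    simp only [hB, Finset.coe_erase, Set.mem_sdiff, Finset.mem_coe, Finset.mem_powerset] at hG'
    exact hGF (hG'.1.antisymm hG.2)
  have hsub : (A \ {F}) ∪ (B \ {F}) ⊆ vertexSet (link (barycentricSubdivision K) {F}) := by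
    intro G hG
    rw [mem_vertexSet_link]
    have hne : F ≠ G := by rintro rfl; simp at hG
    have hGK : G ∈ K.faces ∧ (F ⊆ G ∨ G ⊆ F) := by
      rcases hG with ⟨hG, -⟩ | ⟨hG, -⟩
      · exact ⟨hG.1, Or.inl hG.2⟩
      · simp only [hB, Finset.coe_erase, Set.mem_sdiff, Finset.mem_coe, Finset.mem_powerset,
          Set.mem_singleton_iff] at hG
        exact ⟨(K.isRelLowerSet_faces hF).2 hG.1 (Finset.nonempty_iff_ne_empty.2 hG.2), Or.inr hG.1⟩
    refine ⟨hne, by simp, ?_, ?_⟩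
    · intro H hH
      rcases Finset.mem_insert.1 hH with rfl | hH
      · exact hF
      · rw [Finset.mem_singleton.1 hH]; exact hGK.1
    · rw [Finset.coe_pair]
      rcases hGK.2 with h | h
      · exact IsChain.pair h
      · rw [Set.pair_comm]
        exact IsChain.pair h
  have := Set.ncard_le_ncard hsub (Set.toFinite _)
  rw [Set.ncard_union_eq hdisj (Set.toFinite _) (Set.toFinite _),
    Set.ncard_sdiff_singleton_of_mem hFA, Set.ncard_sdiff_singleton_of_mem hFB, hBc] at this
  rw [numVertices]
  omega

lemma two_mul_le_two_pow (n : ℕ) (hn : 1 ≤ n) : 2 * n ≤ 2 ^ n := by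
  induction n, hn using Nat.le_induction with
  | base => simp
  | succ n hn ih => rw [pow_succ]; omega

lemma two_mul_lt_two_pow (n : ℕ) (hn : 3 ≤ n) : 2 * n < 2 ^ n := by
  induction n, hn using Nat.le_induction with
  | base => simp
  | succ n hn ih => rw [pow_succ]; omega

/-- The two exponents sum to `d + 2 ≥ 5`, so one of them is at least 3, where `2 * n ≤ 2 ^ n` is
strict. -/
lemma two_mul_lt_two_pow_add_two_pow {d k : ℕ} (hd : 3 ≤ d) (hk : k ≤ d) :
    2 * d < 2 ^ (d - k + 1) + 2 ^ (k + 1) - 4 := by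
  have h1 := two_mul_le_two_pow (d - k + 1) (by omega)
  have h2 := two_mul_le_two_pow (k + 1) (by omega)
  by_cases h : 2 ≤ k
  · have := two_mul_lt_two_pow (k + 1) (by omega)
    omega
  · have := two_mul_lt_two_pow (d - k + 1) (by omega)
    omega

/-! ### The barycentric subdivision is balanced -/

lemma exists_flag {V : Type*} [DecidableEq V] (s : Finset V) :
    ∃ C : Finset (Finset V), C.card = s.card ∧ (∀ F ∈ C, F.Nonempty ∧ F ⊆ s) ∧
      IsChain (· ⊆ ·) (C : Set (Finset V)) := by
  induction s using Finset.induction_on with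
  | empty => exact ⟨∅, by simp⟩
  | insert a s ha ih =>
    obtain ⟨C, hC, hCs, hch⟩ := ih
    have hnot : insert a s ∉ C := fun h => ha ((hCs _ h).2 (by simp))
    refine ⟨insert (insert a s) C, ?_, ?_, ?_⟩
    · rw [Finset.card_insert_of_notMem hnot, Finset.card_insert_of_notMem ha, hC]
    · intro F hF
      rcases Finset.mem_insert.1 hF with rfl | hF
      · simp
      · exact ⟨(hCs F hF).1, (hCs F hF).2.trans (Finset.subset_insert a s)⟩
    · rw [Finset.coe_insert]
      exact hch.insert fun F hF _ => Or.inr ((hCs F hF).2.trans (Finset.subset_insert a s))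

/-- Cardinality is injective on chains, so dimension is a proper colouring; a complete flag in a
facet attains dimension `d`. -/
lemma isBalanced_barycentricSubdivision {V : Type*} [DecidableEq V] {d : ℕ}
    {K : PreAbstractSimplicialComplex V} (hK : HasDim d K) :
    IsBalanced d (barycentricSubdivision K) := by
  have hinj : ∀ C ∈ (barycentricSubdivision K).faces, Set.InjOn Finset.card (C : Set (Finset V)) := by
    intro C hC F hF G hG h
    rcases hC.2.2.total hF hG with hFG | hFG
    · exact Finset.eq_of_subset_of_card_le hFG h.ge
    · exact (Finset.eq_of_subset_of_card_le hFG h.le).symm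
  have hpos : ∀ F ∈ K.faces, 1 ≤ F.card ∧ F.card ≤ d + 1 := fun F hF =>
    ⟨(K.isRelLowerSet_faces hF).1.card_pos, hK.2 F hF⟩
  refine ⟨⟨?_, ?_⟩, fun F => Fin.ofNat (d + 1) (F.card - 1), ?_⟩
  · obtain ⟨σ, hσ, hσc⟩ := hK.1
    obtain ⟨C, hC, hCs, hch⟩ := exists_flag σ
    refine ⟨C, ⟨Finset.card_pos.1 (by omega), fun F hF => ?_, hch⟩, by omega⟩
    exact (K.isRelLowerSet_faces hσ).2 (hCs F hF).2 (hCs F hF).1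
  · intro C hC
    have : C.card ≤ (Finset.Icc 1 (d + 1)).card :=
      Finset.card_le_card_of_injOn Finset.card
        (fun F hF => by simpa using hpos F (hC.2.1 F hF)) (hinj C hC)
    simpa using this
  · intro F G hne hFG h
    have hF := hpos F (hFG.2.1 F (by simp))
    have hG := hpos G (hFG.2.1 G (by simp))
    have h' : (F.card - 1) % (d + 1) = (G.card - 1) % (d + 1) := congrArg Fin.val h
    rw [Nat.mod_eq_of_lt (by omega), Nat.mod_eq_of_lt (by omega)] at h'
    exact hne (hinj _ hFG (by simp) (by simp) (show F.card = G.card by omega))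

/-! ### Codimension-one faces of PL spheres -/

open Filter Topology

lemma mem_geomSimplex {V : Type*} [Fintype V] [DecidableEq V] {s : Finset V} {x : V → ℝ} :
    x ∈ geomSimplex s ↔ (∀ v, 0 ≤ x v) ∧ (∀ v ∉ s, x v = 0) ∧ ∑ v, x v = 1 := by
  constructor
  · intro hx
    have hconv : Convex ℝ {x : V → ℝ | (∀ v, 0 ≤ x v) ∧ (∀ v ∉ s, x v = 0) ∧ ∑ v, x v = 1} := by
      rintro x ⟨hx, hxs, hx1⟩ y ⟨hy, hys, hy1⟩ a b ha hb hab
      refine ⟨fun v => ?_, fun v hv => ?_, ?_⟩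
      · exact add_nonneg (mul_nonneg ha (hx v)) (mul_nonneg hb (hy v))
      · simp [hxs v hv, hys v hv]
      · simp [Finset.sum_add_distrib, ← Finset.mul_sum, hx1, hy1, hab]
    refine convexHull_min ?_ hconv hx
    rintro _ ⟨v, hv, rfl⟩
    refine ⟨fun u => ?_, fun u hu => ?_, ?_⟩
    · by_cases h : u = v
      · subst h; simp
      · simp [h]
    · have : u ≠ v := by rintro rfl; exact hu hv
      simp [this]
    · simp
  · rintro ⟨hx, hxs, hx1⟩
    have hs : ∑ v ∈ s, x v = 1 := by
      rw [← hx1]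
      exact Finset.sum_subset (Finset.subset_univ s) fun v _ hv => hxs v hv
    have : x = ∑ v ∈ s, x v • (Pi.single v 1 : V → ℝ) := by
      ext u
      rw [Finset.sum_apply]
      by_cases hu : u ∈ s
      · rw [Finset.sum_eq_single_of_mem u hu]
        · simp
        · intro v _ hv
          simp [hv.symm]
      · rw [hxs u hu, Finset.sum_eq_zero]
        intro v hv
        have : u ≠ v := by rintro rfl; exact hu hv
        simp [this]
    rw [this]
    exact (convex_convexHull ℝ _).sum_mem (fun v _ => hx v) hs
      fun v hv => subset_convexHull ℝ _ ⟨v, hv, rfl⟩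

lemma convex_geomSimplex {V : Type*} [DecidableEq V] (s : Finset V) :
    Convex ℝ (geomSimplex s) :=
  convex_convexHull ℝ _

lemma isCompact_geomSimplex {V : Type*} [Fintype V] [DecidableEq V] (s : Finset V) :
    IsCompact (geomSimplex s) :=
  ((s.finite_toSet).image _).isCompact_convexHull (𝕜 := ℝ)

lemma geomSimplex_mono {V : Type*} [DecidableEq V] {s t : Finset V} (h : s ⊆ t) :
    geomSimplex s ⊆ geomSimplex t :=
  convexHull_mono (Set.image_mono (by exact_mod_cast h))

lemma geomSimplex_subset_realization {V : Type*} [DecidableEq V]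
    {K : PreAbstractSimplicialComplex V} {s : Finset V} (hs : s ∈ K.faces) :
    geomSimplex s ⊆ realization K :=
  Set.subset_biUnion_of_mem (u := geomSimplex) hs

lemma exists_pos_mem_geomSimplex {V : Type*} [Fintype V] [DecidableEq V] {s : Finset V}
    (hs : s.Nonempty) : ∃ c ∈ geomSimplex s, ∀ v ∈ s, 0 < c v := by
  have hc : (0 : ℝ) < s.card := by exact_mod_cast hs.card_pos
  refine ⟨fun v => if v ∈ s then (s.card : ℝ)⁻¹ else 0, mem_geomSimplex.2 ⟨fun v => ?_, ?_, ?_⟩, ?_⟩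
  · split_ifs <;> positivity
  · intro v hv
    simp [hv]
  · simp [hc.ne']
  · intro v hv
    simp [hv, hc]

lemma subset_of_pos_of_mem_geomSimplex {V : Type*} [Fintype V] [DecidableEq V] {s t : Finset V}
    {x : V → ℝ} (hx : x ∈ geomSimplex s) (h : ∀ v ∈ t, 0 < x v) : t ⊆ s := by
  intro v hv
  by_contra hvs
  exact (h v hv).ne' ((mem_geomSimplex.1 hx).2.1 v hvs)

lemma mem_realization_simplexBoundary {n : ℕ} {y : Fin (n + 1) → ℝ} :
    y ∈ realization (simplexBoundary n) ↔ (∀ i, 0 ≤ y i) ∧ ∑ i, y i = 1 ∧ ∃ i, y i = 0 := by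
  rw [realization, Set.mem_iUnion₂]
  constructor
  · rintro ⟨s, hs, hy⟩
    rw [mem_geomSimplex] at hy
    obtain ⟨i, hi⟩ : ∃ i, i ∉ s := by
      by_contra! h
      exact hs.2 (Finset.eq_univ_iff_forall.2 h)
    exact ⟨hy.1, hy.2.2, i, hy.2.1 i hi⟩
  · rintro ⟨h0, h1, i, hi⟩
    refine ⟨Finset.univ.filter (y · ≠ 0), ⟨?_, ?_⟩, mem_geomSimplex.2 ⟨h0, by simp, h1⟩⟩
    · obtain ⟨j, -, hj⟩ := Finset.exists_ne_zero_of_sum_ne_zero (h1.trans_ne one_ne_zero)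
      exact ⟨j, by simpa using hj⟩
    · intro h
      have : i ∈ Finset.univ.filter (y · ≠ 0) := by rw [h]; exact Finset.mem_univ i
      exact (Finset.mem_filter.1 this).2 hi

/-- A convex set that an injective affine map takes to a neighbourhood of a point in the boundary
of a simplex is relatively open near the preimage of that point. -/
lemma exists_combo_eq_of_affine_chart {E : Type*} [AddCommGroup E] [Module ℝ E] {n : ℕ}
    {U : Set E} (hU : Convex ℝ U) (A : E →ᵃ[ℝ] (Fin (n + 1) → ℝ))
    (hmaps : ∀ u ∈ U, A u ∈ realization (simplexBoundary n)) (hinj : Set.InjOn A U) {x : E}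
    (hx : x ∈ U) (hnhds : ∀ᶠ y in 𝓝[realization (simplexBoundary n)] (A x), y ∈ A '' U) {p : E}
    (hp : p ∈ U) : ∃ u ∈ U, ∃ a b : ℝ, 0 < a ∧ 0 < b ∧ a + b = 1 ∧ a • u + b • p = x := by
  set S := realization (simplexBoundary n) with hS
  -- The midpoint has a zero coordinate, and nonnegativity makes both endpoints vanish there.
  have hmid : ∀ y ∈ A '' U, ∀ z ∈ A '' U, ∃ k, y k = 0 ∧ z k = 0 := by
    rintro _ ⟨u, hu, rfl⟩ _ ⟨u', hu', rfl⟩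
    have h1 := hmaps _ (hU hu hu' (a := 1 / 2) (b := 1 / 2) (by norm_num) (by norm_num)
      (by norm_num))
    rw [Convex.combo_affine_apply (by norm_num)] at h1
    obtain ⟨-, -, k, hk⟩ := mem_realization_simplexBoundary.1 h1
    have h2 := (mem_realization_simplexBoundary.1 (hmaps u hu)).1 k
    have h3 := (mem_realization_simplexBoundary.1 (hmaps u' hu')).1 k
    simp only [Pi.add_apply, Pi.smul_apply, smul_eq_mul] at hk
    exact ⟨k, by linarith, by linarith⟩
  obtain ⟨h0, h1, i, hi⟩ := mem_realization_simplexBoundary.1 (hmaps x hx)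
  have htend : ∀ c : Fin (n + 1) → ℝ, Tendsto (fun ε : ℝ => A x + ε • (c - A x)) (𝓝[>] 0)
      (𝓝 (A x)) := by
    intro c
    have : Continuous (fun ε : ℝ => A x + ε • (c - A x)) := by fun_prop
    simpa using (this.tendsto 0).mono_left nhdsWithin_le_nhds
  -- Moving towards an interior point `c` of the facet opposite `i` stays in the boundary and leaves
  -- `i` as the only zero coordinate.
  have hpath : ∀ i, A x i = 0 → ∃ c : Fin (n + 1) → ℝ, (∀ k, k ≠ i → 0 < c k) ∧
      ∀ᶠ ε : ℝ in 𝓝[>] 0, A x + ε • (c - A x) ∈ A '' U := by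
    intro i hi
    have hne : (Finset.univ.erase i).Nonempty := by
      obtain ⟨j, -, hj⟩ := Finset.exists_ne_zero_of_sum_ne_zero (h1.trans_ne one_ne_zero)
      exact ⟨j, by simp; rintro rfl; exact hj hi⟩
    obtain ⟨c, hc, hcpos⟩ := exists_pos_mem_geomSimplex hne
    rw [mem_geomSimplex] at hc
    refine ⟨c, fun k hk => hcpos k (by simp [hk]), ?_⟩
    refine (tendsto_nhdsWithin_iff.2 ⟨htend c, ?_⟩).eventually hnhds
    filter_upwards [Ioo_mem_nhdsGT (zero_lt_one (α := ℝ))] with ε hε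
    refine mem_realization_simplexBoundary.2 ⟨fun k => ?_, ?_, i, ?_⟩
    · have : 0 ≤ (1 - ε) * A x k + ε * c k :=
        add_nonneg (mul_nonneg (by linarith [hε.2]) (h0 k)) (mul_nonneg hε.1.le (hc.1 k))
      simp only [Pi.add_apply, Pi.smul_apply, Pi.sub_apply, smul_eq_mul]
      linarith
    · simp [Finset.sum_add_distrib, ← Finset.mul_sum, h1, hc.2.2]
    · simp [hi, hc.2.1 i]
  -- Two zeros of `A x` would give two image points without a common zero, against `hmid`. So `A x`
  -- is interior to a facet.
  have hpos : ∀ j, j ≠ i → 0 < A x j := by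
    intro j hj
    refine (h0 j).lt_of_ne' fun hj0 => ?_
    obtain ⟨c, hc, hcU⟩ := hpath i hi
    obtain ⟨c', hc', hcU'⟩ := hpath j hj0
    obtain ⟨ε, hε, hε', hε0⟩ :=
      (hcU.and (hcU'.and (Ioo_mem_nhdsGT (zero_lt_one (α := ℝ))))).exists
    obtain ⟨k, hk, hk'⟩ := hmid _ hε _ hε'
    have hpos' : ∀ c : Fin (n + 1) → ℝ, 0 < c k → (A x + ε • (c - A x)) k ≠ 0 := by
      intro c hc
      have : 0 < (1 - ε) * A x k + ε * c k :=
        add_pos_of_nonneg_of_pos (mul_nonneg (by linarith [hε0.2]) (h0 k)) (mul_pos hε0.1 hc)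
      simp only [Pi.add_apply, Pi.smul_apply, Pi.sub_apply, smul_eq_mul]
      linarith
    by_cases hki : k = i
    · exact hpos' c' (hc' k (by rintro rfl; exact hj hki)) hk'
    · exact hpos' c (hc k hki) hk
  have hpi : A p i = 0 := by
    obtain ⟨k, hk, hk'⟩ := hmid _ ⟨x, hx, rfl⟩ _ ⟨p, hp, rfl⟩
    by_cases hki : k = i
    · rwa [← hki]
    · exact absurd hk (hpos k hki).ne'
  have hp1 := (mem_realization_simplexBoundary.1 (hmaps p hp)).2.1
  -- `A p` lies in the same facet, so the segment from `A p` can be prolonged a little beyond `A x`.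
  have hrefl : ∀ᶠ ε : ℝ in 𝓝[>] 0, A x + ε • ((2 : ℝ) • A x - A p - A x) ∈ A '' U := by
    refine (tendsto_nhdsWithin_iff.2 ⟨htend _, ?_⟩).eventually hnhds
    have h : ∀ k, ∀ᶠ ε : ℝ in 𝓝[>] 0, 0 ≤ (A x + ε • ((2 : ℝ) • A x - A p - A x)) k := by
      intro k
      by_cases hki : k = i
      · subst hki
        exact Eventually.of_forall fun ε => by simp [hi, hpi]
      · exact (((continuous_apply k).tendsto (A x)).comp (htend _)).eventually
          (eventually_ge_nhds (hpos k hki))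
    filter_upwards [eventually_all.2 h] with ε hε
    refine mem_realization_simplexBoundary.2 ⟨hε, ?_, i, ?_⟩
    · simp only [Pi.add_apply, Pi.smul_apply, Pi.sub_apply, smul_eq_mul, Finset.sum_add_distrib,
        Finset.sum_sub_distrib, ← Finset.mul_sum, h1, hp1]
      ring
    · simp [hi, hpi]
  obtain ⟨t, ⟨u, hu, hut⟩, ht⟩ := (hrefl.and self_mem_nhdsWithin).exists
  have ht : 0 < t := ht
  have hab : 1 / (1 + t) + t / (1 + t) = 1 := by field_simp
  refine ⟨u, hu, 1 / (1 + t), t / (1 + t), by positivity, by positivity, hab, ?_⟩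
  refine hinj (hU hu hp (by positivity) (by positivity) hab) hx ?_
  rw [Convex.combo_affine_apply hab, hut]
  ext k
  simp only [Pi.add_apply, Pi.smul_apply, Pi.sub_apply, smul_eq_mul]
  field_simp
  ring

/-- If a codimension-one face lies in a single facet, then every finite closed convex cover has
a member that contains a neighbourhood of an interior point of it. -/
lemma exists_eventually_mem_of_unique_facet {V : Type*} [Fintype V] [DecidableEq V]
    {L : PreAbstractSimplicialComplex V} {σ : Finset V} (hσ : σ ∈ L.faces) {w : V} (hw : w ∈ σ)
    (hne : (σ.erase w).Nonempty) (huniq : ∀ s ∈ L.faces, σ.erase w ⊆ s → s ⊆ σ)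
    {𝒯 : Set (Set (V → ℝ))} (hfin : 𝒯.Finite) (hclosed : ∀ t ∈ 𝒯, IsClosed t)
    (hconv : ∀ t ∈ 𝒯, Convex ℝ t) (hcover : realization L ⊆ ⋃₀ 𝒯) :
    ∃ t ∈ 𝒯, ∃ x ∈ geomSimplex (σ.erase w), (∀ v ∈ σ.erase w, 0 < x v) ∧
      ∀ᶠ y in 𝓝[realization L] x, y ∈ t ∧ y ∈ geomSimplex σ := by
  obtain ⟨p, hp, hppos⟩ := exists_pos_mem_geomSimplex (show σ.Nonempty from ⟨w, hw⟩)
  obtain ⟨q, hq, hqpos⟩ := exists_pos_mem_geomSimplex hne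
  set X := geomSimplex (σ.erase w) with hX
  -- Only members reaching off the face `X` can contain a neighbourhood; they already cover `X`,
  -- whose points are limits of interior points of `σ`.
  set thick : Set (Set (V → ℝ)) := {t ∈ 𝒯 | ∃ z ∈ t, z ∈ geomSimplex σ ∧ 0 < z w} with hthick
  have hthickfin : thick.Finite := hfin.subset (Set.sep_subset _ _)
  have hthickcover : ∀ x ∈ X, ∃ t ∈ thick, x ∈ t := by
    intro x hx
    have hclosed' : IsClosed (⋃₀ thick) := by
      rw [Set.sUnion_eq_biUnion]
      exact Set.Finite.isClosed_biUnion hthickfin fun t ht => hclosed t ht.1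
    have htend : Tendsto (fun ε : ℝ => (1 - ε) • x + ε • p) (𝓝[>] 0) (𝓝 x) := by
      have : Continuous (fun ε : ℝ => (1 - ε) • x + ε • p) := by fun_prop
      simpa using (this.tendsto 0).mono_left nhdsWithin_le_nhds
    refine hclosed'.mem_of_tendsto htend ?_
    filter_upwards [Ioo_mem_nhdsGT (zero_lt_one (α := ℝ))] with ε hε
    have hxσ := geomSimplex_mono (Finset.erase_subset w σ) hx
    have hmem : (1 - ε) • x + ε • p ∈ geomSimplex σ :=
      convex_geomSimplex σ hxσ hp (by linarith [hε.2]) hε.1.le (by ring)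
    have hpos : ∀ v ∈ σ, 0 < ((1 - ε) • x + ε • p) v := fun v hv =>
      add_pos_of_nonneg_of_pos (mul_nonneg (by linarith [hε.2]) ((mem_geomSimplex.1 hx).1 v))
        (mul_pos hε.1 (hppos v hv))
    obtain ⟨t, ht, hmt⟩ := hcover (geomSimplex_subset_realization hσ hmem)
    exact ⟨t, ⟨ht, _, hmt, hmem, hpos w hw⟩, hmt⟩
  have hXc : IsCompact X := isCompact_geomSimplex _
  have : CompactSpace X := isCompact_iff_compactSpace.1 hXc
  have : Nonempty X := ⟨⟨q, hq⟩⟩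
  have : Finite thick := hthickfin
  -- Baire: one of finitely many closed sets covering `X` has interior in `X`.
  obtain ⟨⟨t, ht⟩, ⟨x₀, hx₀⟩, hint⟩ := nonempty_interior_of_iUnion_of_closed
    (f := fun t : thick => ((↑) : X → V → ℝ) ⁻¹' (t : Set (V → ℝ)))
    (fun t => (hclosed t t.2.1).preimage continuous_subtype_val)
    (by
      ext ⟨x, hx⟩
      simpa using hthickcover x hx)
  have hnear₀ : ∀ᶠ y in 𝓝[X] x₀, ∀ᶠ z in 𝓝[X] y, z ∈ t := by
    rw [eventually_eventually_nhdsWithin]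
    have := mem_interior_iff_mem_nhds.1 hint
    rw [mem_nhds_subtype_iff_nhdsWithin] at this
    filter_upwards [this, self_mem_nhdsWithin] with y hy hyX
    obtain ⟨z, hz, rfl⟩ := hy
    exact hz
  obtain ⟨x, hx, hxpos, hnear⟩ : ∃ x ∈ X, (∀ v ∈ σ.erase w, 0 < x v) ∧ ∀ᶠ z in 𝓝[X] x, z ∈ t := by
    have htend : Tendsto (fun ε : ℝ => (1 - ε) • x₀ + ε • q) (𝓝[>] 0) (𝓝 x₀) := by
      have : Continuous (fun ε : ℝ => (1 - ε) • x₀ + ε • q) := by fun_prop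
      simpa using (this.tendsto 0).mono_left nhdsWithin_le_nhds
    have hIoo : ∀ᶠ ε : ℝ in 𝓝[>] 0, ε ∈ Set.Ioo (0 : ℝ) 1 := Ioo_mem_nhdsGT zero_lt_one
    have hmemX : ∀ᶠ ε : ℝ in 𝓝[>] 0, (1 - ε) • x₀ + ε • q ∈ X := by
      filter_upwards [hIoo] with ε hε
      exact convex_geomSimplex _ hx₀ hq (by linarith [hε.2]) hε.1.le (by ring)
    obtain ⟨ε, h1, h2, hε⟩ :=
      (((tendsto_nhdsWithin_iff.2 ⟨htend, hmemX⟩).eventually hnear₀).and (hmemX.and hIoo)).exists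
    refine ⟨_, h2, fun v hv => ?_, h1⟩
    exact add_pos_of_nonneg_of_pos
      (mul_nonneg (by linarith [hε.2]) ((mem_geomSimplex.1 hx₀).1 v)) (mul_pos hε.1 (hqpos v hv))
  refine ⟨t, ht.1, x, hx, hxpos, ?_⟩
  obtain ⟨z, hzt, hzσ, hzw⟩ := ht.2
  have hxw : x w = 0 := (mem_geomSimplex.1 hx).2.1 w (by simp)
  have hypos : ∀ᶠ y in 𝓝 x, ∀ v ∈ σ.erase w, 0 < y v :=
    (Filter.eventually_all_finset _).2 fun v hv =>
      ((continuous_apply v).tendsto x).eventually (lt_mem_nhds (hxpos v hv))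
  -- Near `x` the coordinates in `σ.erase w` stay positive, so any face carrying `y` contains
  -- `σ.erase w` and lies in `σ`.
  have hyσ : ∀ᶠ y in 𝓝[realization L] x, y ∈ geomSimplex σ := by
    filter_upwards [hypos.filter_mono nhdsWithin_le_nhds, self_mem_nhdsWithin] with y hy hyL
    obtain ⟨s, hs, hys⟩ := Set.mem_iUnion₂.1 hyL
    exact geomSimplex_mono (huniq s hs (subset_of_pos_of_mem_geomSimplex hys hy)) hys
  -- `b y` is the projection of `y` from `z` to the hyperplane of the face opposite to `w`.
  set b : (V → ℝ) → (V → ℝ) := fun y => (1 - y w / z w)⁻¹ • (y - (y w / z w) • z) with hb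
  have hlam : Tendsto (fun y : V → ℝ => y w / z w) (𝓝 x) (𝓝 0) := by
    have : Continuous (fun y : V → ℝ => y w / z w) := by fun_prop
    simpa [hxw] using this.tendsto x
  have hbt : Tendsto b (𝓝 x) (𝓝 x) := by
    have h1 : Tendsto (fun y : V → ℝ => (1 - y w / z w)⁻¹) (𝓝 x) (𝓝 (1 - 0)⁻¹) :=
      (tendsto_const_nhds.sub hlam).inv₀ (by norm_num)
    have h2 : Tendsto (fun y : V → ℝ => y - (y w / z w) • z) (𝓝 x) (𝓝 (x - (0 : ℝ) • z)) :=
      tendsto_id.sub (hlam.smul tendsto_const_nhds)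
    simpa using h1.smul h2
  have hbX : ∀ᶠ y in 𝓝[realization L] x, b y ∈ X := by
    filter_upwards [(hbt.eventually hypos).filter_mono nhdsWithin_le_nhds, hyσ,
      (hlam.eventually (gt_mem_nhds zero_lt_one)).filter_mono nhdsWithin_le_nhds] with y hy hyσ hl
    have hyσ := mem_geomSimplex.1 hyσ
    have hzσ := mem_geomSimplex.1 hzσ
    have hbw : b y w = 0 := by
      simp only [hb, Pi.smul_apply, Pi.sub_apply, smul_eq_mul]
      field_simp
      simp
    have hb0 : ∀ v ∉ σ.erase w, b y v = 0 := by
      intro v hv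
      by_cases hvw : v = w
      · rwa [hvw]
      · have hvσ : v ∉ σ := fun h => hv (Finset.mem_erase.2 ⟨hvw, h⟩)
        simp [hb, hyσ.2.1 v hvσ, hzσ.2.1 v hvσ]
    refine mem_geomSimplex.2 ⟨fun v => ?_, hb0, ?_⟩
    · by_cases hv : v ∈ σ.erase w
      · exact (hy v hv).le
      · exact (hb0 v hv).ge
    · have : (1 : ℝ) - y w / z w ≠ 0 := by linarith
      simp only [hb, Pi.smul_apply, Pi.sub_apply, smul_eq_mul, ← Finset.mul_sum,
        Finset.sum_sub_distrib, hyσ.2.2, hzσ.2.2, mul_one]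
      exact inv_mul_cancel₀ this
  filter_upwards [(tendsto_nhdsWithin_iff.2 ⟨hbt.mono_left nhdsWithin_le_nhds, hbX⟩).eventually
    hnear, hyσ, (hlam.eventually (gt_mem_nhds zero_lt_one)).filter_mono nhdsWithin_le_nhds]
    with y hbyt hyσ hl
  refine ⟨?_, hyσ⟩
  have hne1 : (1 : ℝ) - y w / z w ≠ 0 := by linarith
  have hl0 : 0 ≤ y w / z w := div_nonneg ((mem_geomSimplex.1 hyσ).1 w) hzw.le
  -- `y` lies on the segment from `b y` to `z`, both in the convex set `t`.
  have := hconv t ht.1 hbyt hzt (a := 1 - y w / z w) (b := y w / z w) (by linarith) hl0 (by ring)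
  convert this using 1
  simp only [hb]
  rw [smul_inv_smul₀ hne1]
  simp

theorem not_plHomeomorphic_of_unique_facet {V : Type*} [Fintype V] [DecidableEq V] {n : ℕ}
    {L : PreAbstractSimplicialComplex V} {σ : Finset V} (hσ : σ ∈ L.faces) {w : V} (hw : w ∈ σ)
    (hne : (σ.erase w).Nonempty) (huniq : ∀ s ∈ L.faces, σ.erase w ⊆ s → s ⊆ σ) :
    ¬ PLHomeomorphic L (simplexBoundary n) := by
  rintro ⟨f, T, ⟨hTfin, hTspace, -⟩, hTaff⟩
  obtain ⟨_, ⟨t, ht, rfl⟩, x, hx, hxpos, hnear⟩ := exists_eventually_mem_of_unique_facet hσ hw hne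
    huniq (𝒯 := (fun t : Finset (V → ℝ) => convexHull ℝ (t : Set (V → ℝ))) '' T.faces)
    (hTfin.image _)
    (by
      rintro _ ⟨t, -, rfl⟩
      exact (t.finite_toSet.isCompact_convexHull (𝕜 := ℝ)).isClosed)
    (by
      rintro _ ⟨t, -, rfl⟩
      exact convex_convexHull ℝ _)
    (by
      rw [← hTspace]
      intro y hy
      obtain ⟨t, ht, hyt⟩ := Geometry.SimplicialComplex.mem_space_iff.1 hy
      exact ⟨_, ⟨t, ht, rfl⟩, hyt⟩)
  obtain ⟨A, hA⟩ := hTaff t ht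
  obtain ⟨δ, hδ, hball⟩ := Metric.mem_nhdsWithin_iff.1 hnear
  set U := geomSimplex σ ∩ Metric.ball x δ with hU
  have hσL := geomSimplex_subset_realization hσ
  have hxσ : x ∈ geomSimplex σ := geomSimplex_mono (Finset.erase_subset w σ) hx
  have hxU : x ∈ U := ⟨hxσ, Metric.mem_ball_self hδ⟩
  have hfA : ∀ u (hu : u ∈ U), (f ⟨u, hσL hu.1⟩ : Fin (n + 1) → ℝ) = A u := fun u hu =>
    hA ⟨u, hσL hu.1⟩ (hball ⟨hu.2, hσL hu.1⟩).1
  obtain ⟨p, hp, hpw⟩ : ∃ p ∈ U, 0 < p w := by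
    obtain ⟨c, hc, hcpos⟩ := exists_pos_mem_geomSimplex (show σ.Nonempty from ⟨w, hw⟩)
    have htend : Tendsto (fun ε : ℝ => (1 - ε) • x + ε • c) (𝓝[>] 0) (𝓝 x) := by
      have : Continuous (fun ε : ℝ => (1 - ε) • x + ε • c) := by fun_prop
      simpa using (this.tendsto 0).mono_left nhdsWithin_le_nhds
    obtain ⟨ε, h1, hε⟩ := ((htend.eventually (Metric.ball_mem_nhds x hδ)).and
      (Ioo_mem_nhdsGT (zero_lt_one (α := ℝ)))).exists
    refine ⟨_, ⟨convex_geomSimplex σ hxσ hc (by linarith [hε.2]) hε.1.le (by ring), h1⟩, ?_⟩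
    exact add_pos_of_nonneg_of_pos
      (mul_nonneg (by linarith [hε.2]) ((mem_geomSimplex.1 hx).1 w)) (mul_pos hε.1 (hcpos w hw))
  obtain ⟨u, hu, a, b, ha, hb, -, hab⟩ := exists_combo_eq_of_affine_chart
    ((convex_geomSimplex σ).inter (convex_ball x δ)) A
    (fun u hu => hfA u hu ▸ (f ⟨u, hσL hu.1⟩).2)
    (by
      intro u hu u' hu' h
      rw [← hfA u hu, ← hfA u' hu'] at h
      exact congrArg Subtype.val (f.injective (Subtype.ext h)))
    hxU
    (by
      rw [← hfA x hxU, ← map_nhds_subtype_val, eventually_map]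
      have hc : Tendsto (fun y => (f.symm y : V → ℝ)) (𝓝 (f ⟨x, hσL hxσ⟩)) (𝓝 x) := by
        have := (continuous_subtype_val.comp f.symm.continuous).tendsto (f ⟨x, hσL hxσ⟩)
        simpa [Function.comp_def] using this
      filter_upwards [hc.eventually (Metric.ball_mem_nhds x hδ)] with y hy
      have hyU : (f.symm y : V → ℝ) ∈ U := ⟨(hball ⟨hy, (f.symm y).2⟩).2, hy⟩
      exact ⟨_, hyU, by rw [← hfA _ hyU]; simp⟩)
    hp
  -- `x` is strictly between `u` and `p`, yet `x w = 0`, `u w ≥ 0` and `p w > 0`.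
  have hxw : x w = 0 := (mem_geomSimplex.1 hx).2.1 w (by simp)
  have h1 : a * u w + b * p w = x w := congrFun hab w
  have h2 := mul_nonneg ha.le ((mem_geomSimplex.1 hu.1).1 w)
  have h3 := mul_pos hb hpw
  linarith

/-! ### Combinatorial manifolds -/

lemma IsCombinatorialSphere.hasFacetExchange {V : Type*} [Fintype V] [DecidableEq V] {m : ℕ}
    (hm : 1 ≤ m) {L : PreAbstractSimplicialComplex V} (hL : IsCombinatorialSphere m L) :
    HasFacetExchange m L := by
  intro σ hσ hσc w hw
  by_contra! h
  have hec : (σ.erase w).card = m := by rw [Finset.card_erase_of_mem hw]; omega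
  refine not_plHomeomorphic_of_unique_facet hσ hw (Finset.card_pos.1 (by omega)) ?_ hL.2
  intro s hs hsub
  obtain ⟨s', hs', hss', hs'c⟩ := hL.1.2 s hs
  obtain ⟨a, ha, rfl⟩ : ∃ a ∉ σ.erase w, insert a (σ.erase w) = s' := by
    obtain ⟨a, ha⟩ : ∃ a, s' \ σ.erase w = {a} := by
      rw [← Finset.card_eq_one, Finset.card_sdiff_of_subset (hsub.trans hss')]
      omega
    have hmem : a ∈ s' \ σ.erase w := by simp [ha]
    rw [Finset.mem_sdiff] at hmem
    refine ⟨a, hmem.2, ?_⟩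
    rw [Finset.insert_eq, ← ha, Finset.sdiff_union_of_subset (hsub.trans hss')]
  by_cases haσ : a ∈ σ
  · exact hss'.trans (Finset.insert_subset haσ (Finset.erase_subset w σ))
  · exact absurd hs' (h a haσ)

/-- The exchange takes place in the link of another vertex `v` of `σ`, a sphere of dimension `d - 1
≥ 1`; adding `v` back gives the facet of `K`. -/
lemma IsCombinatorialManifold.hasFacetExchange {V : Type*} [Fintype V] [DecidableEq V] {d : ℕ}
    (hd : 2 ≤ d) {K : PreAbstractSimplicialComplex V} (hK : IsCombinatorialManifold d K) :
    HasFacetExchange d K := by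
  intro σ hσ hσc w hw
  obtain ⟨v, hv⟩ : (σ.erase w).Nonempty := by
    rw [← Finset.card_pos, Finset.card_erase_of_mem hw]; omega
  obtain ⟨hvw, hvσ⟩ := Finset.mem_erase.1 hv
  have hvc : (σ.erase v).card = d := by rw [Finset.card_erase_of_mem hvσ]; omega
  have hlink : σ.erase v ∈ (link K {v}).faces := by
    refine ⟨Finset.card_pos.1 (by omega), by simp, ?_⟩
    rwa [← Finset.insert_eq, Finset.insert_erase hvσ]
  obtain ⟨w', hw', hmem⟩ := (hK.2.2 v (vertex_of_mem hσ hvσ)).hasFacetExchange (by omega) _ hlink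
    (by omega) w (Finset.mem_erase.2 ⟨hvw.symm, hw⟩)
  have hv' : v ≠ w' := by
    rintro rfl
    simpa using hmem.2.1
  refine ⟨w', fun h => hw' (Finset.mem_erase.2 ⟨hv'.symm, h⟩), ?_⟩
  have h3 := hmem.2.2
  have : insert w' (σ.erase w) = {v} ∪ insert w' ((σ.erase v).erase w) := by
    ext a
    simp only [Finset.mem_insert, Finset.mem_erase, Finset.mem_union, Finset.mem_singleton]
    by_cases hav : a = v
    · subst hav; simp [hvw, hvσ]
    · simp [hav]
  rwa [this]

end CrossFlips

theorem mainTheorem7 {V : Type*} [Fintype V] [DecidableEq V] (d : ℕ) (hd : 3 ≤ d)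
    (Δ : PreAbstractSimplicialComplex V) (hΔ : CrossFlips.IsCombinatorialManifold d Δ) :
    CrossFlips.IsIrreducible d (CrossFlips.barycentricSubdivision Δ) ∧
    (∀ (k : ℕ) (F : Finset V), F ∈ Δ.faces → F.card = k + 1 →
      2 ^ (d - k + 1) + 2 ^ (k + 1) - 4 ≤
        CrossFlips.numVertices (CrossFlips.link (CrossFlips.barycentricSubdivision Δ) {F}) ∧
      2 * d < 2 ^ (d - k + 1) + 2 ^ (k + 1) - 4) ∧
    (∀ (W : Type*) [Fintype W] [DecidableEq W] (K : PreAbstractSimplicialComplex W) (v : W),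
      CrossFlips.IsPure d K → CrossFlips.IsBalanced d K → CrossFlips.IsRemovable d K v →
        CrossFlips.numVertices (CrossFlips.link K {v}) = 2 * d) := by
  have hbound : ∀ (k : ℕ) (F : Finset V), F ∈ Δ.faces → F.card = k + 1 →
      2 ^ (d - k + 1) + 2 ^ (k + 1) - 4 ≤
        CrossFlips.numVertices (CrossFlips.link (CrossFlips.barycentricSubdivision Δ) {F}) ∧
      2 * d < 2 ^ (d - k + 1) + 2 ^ (k + 1) - 4 := fun k F hF hk =>
    ⟨CrossFlips.le_numVertices_link_barycentricSubdivision hΔ.1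
      (hΔ.hasFacetExchange (by omega)) hF hk,
      CrossFlips.two_mul_lt_two_pow_add_two_pow hd (by have := hΔ.1.1.2 F hF; omega)⟩
  refine ⟨⟨CrossFlips.isBalanced_barycentricSubdivision hΔ.1.1, fun F hF => ?_⟩, hbound,
    fun W _ _ K v _ _ hv => CrossFlips.numVertices_link_of_isRemovable hv⟩
  have hFΔ : F ∈ Δ.faces := hF.1.2.1 F (by simp)
  have hpos := (Δ.isRelLowerSet_faces hFΔ).1.card_pos
  have h1 := hbound (F.card - 1) F hFΔ (by omega)
  have h2 := CrossFlips.numVertices_link_of_isRemovable hF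
  omega
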